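/- For integers $n\ge 1$ and $a\le b$, let $K_n^{ab}$ be the integral gain graph on the vertex set $[n]=\{1,\dots,n\}$ having, for all $i<j$ and every integer $g$ with $a\le g\le b$, exactly one edge from $i$ to $j$ with gain $g$. Let $\mathcal A=\mathcal A[K_n^{ab}]$ be its affinographic arrangement, that is, the set of all hyperplanes $x_j-x_i=g$ in $\mathbb R^n$ with $1\le i<j\le n$, $g\in\mathbb Z$, $a\le g\le b$, and let $\mathcal A_0$ be the arrangement that $\mathcal A$ induces on the $(n-1)$-dimensional space $V_0=\{x\in\mathbb R^n: x_1+\dots+x_n=0\}$. The characteristic polynomial of a finite arrangement $\mathcal B$ of affine hyperplanes in a finite-dimensional real vector space $E$ is $$\chi_{\mathcal B}(q)=\sum_{F}\mu(E,F)\,q^{\dim F},$$ where $F$ runs over the nonempty intersections of subfamilies of $\mathcal B$ (including $E$ itself, the empty intersection), ordered by reverse inclusion, and $\mu$ is the Möbius function of this poset. **Theorem.** If $a+b=0$, then $$\chi_{\mathcal A_0}(q)=(-1)^{n-1}\prod_{i=1}^{n-1}(bn-q+i),$$ and if $a+b=1$, then $$\chi_{\mathcal A_0}(q)=(-1)^{n-1}(bn-q)^{n-1}.$$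 In both cases $\chi_{\mathcal A}(q)=q\,\chi_{\mathcal A_0}(q)$; so the characteristic polynomial of $\mathcal A$ in $\mathbb R^n$ is $q$ times the stated product. -/

import Mathlib

open Polynomial

noncomputable section

/-! ### Hyperplane arrangements and their characteristic polynomials -/

namespace Arrangement

variable {E : Type*} [AddCommGroup E] [Module ℝ E]

open scoped Classical in
/-- The flats of a finite arrangement `A` of affine hyperplanes in `E`: the nonempty intersections
of subfamilies of `A`. The empty subfamily gives the whole space `⊤`. -/
def flats (A : Finset (AffineSubspace ℝ E)) : Finset (AffineSubspace ℝ E) :=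
  (A.powerset.image fun B => B.inf id).filter fun F => F ≠ ⊥

/-- The intersection poset of `A`: its flats, ordered by reverse inclusion. -/
abbrev IntersectionPoset (A : Finset (AffineSubspace ℝ E)) : Type _ :=
  {F : AffineSubspace ℝ E // F ∈ flats A}ᵒᵈ

theorem top_mem_flats (A : Finset (AffineSubspace ℝ E)) : (⊤ : AffineSubspace ℝ E) ∈ flats A := by
  classical
  simp only [flats, Finset.mem_filter, Finset.mem_image, Finset.mem_powerset]
  refine ⟨⟨∅, Finset.empty_subset A, Finset.inf_empty⟩, ?_⟩
  exact (AffineSubspace.bot_ne_top ℝ E E).symm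

instance (A : Finset (AffineSubspace ℝ E)) : Fintype (IntersectionPoset A) :=
  inferInstanceAs (Fintype {F : AffineSubspace ℝ E // F ∈ flats A})

open scoped Classical in
instance (A : Finset (AffineSubspace ℝ E)) : LocallyFiniteOrder (IntersectionPoset A) :=
  Fintype.toLocallyFiniteOrder

/-- The least element of the intersection poset, i.e. the whole space. -/
def whole (A : Finset (AffineSubspace ℝ E)) : IntersectionPoset A :=
  OrderDual.toDual ⟨⊤, top_mem_flats A⟩

open scoped Classical in
/-- The characteristic polynomial `χ_A(q) = ∑_F μ(E, F) q ^ dim F` of the arrangement `A`, where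
`F` runs over the flats of `A` and `μ` is the Möbius function of the intersection poset. -/
def charPoly (A : Finset (AffineSubspace ℝ E)) : ℤ[X] :=
  ∑ F : IntersectionPoset A,
    C (IncidenceAlgebra.mu ℤ (whole A) F) *
      X ^ Module.finrank ℝ (OrderDual.ofDual F).1.direction

open scoped Classical in
/-- The arrangement induced by `A` on a linear subspace `W`: the sets `H ∩ W` for `H ∈ A`,
as affine subspaces of `W`. -/
def restrict (A : Finset (AffineSubspace ℝ E)) (W : Submodule ℝ E) :
    Finset (AffineSubspace ℝ W) :=
  A.image fun H => H.comap W.subtype.toAffineMap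

end Arrangement

/-! ### Integral gain graphs and affinographic arrangements -/

/-- A finite integral gain graph on the vertex set `V`. A triple `(i, j, g) ∈ edges` is an edge with
endpoints `i`, `j` which has gain `g` when oriented from `i` to `j`; the same edge in the opposite
orientation is `(j, i, -g)`. There are no loops; edges with the same endpoints and different
gains are allowed. -/
structure IntegralGainGraph (V : Type*) where
  edges : Finset (V × V × ℤ)
  symm : ∀ i j g, (i, j, g) ∈ edges → (j, i, -g) ∈ edges
  loopless : ∀ i g, (i, i, g) ∉ edges

namespace IntegralGainGraph

/-- The hyperplane `x_j - x_i = g` (for `i ≠ j`) in the space `V → ℝ`. -/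
def hyperplane {V : Type*} (i j : V) (g : ℤ) : AffineSubspace ℝ (V → ℝ) where
  carrier := {x | x j - x i = g}
  smul_vsub_vadd_mem' := by
    intro c p₁ p₂ p₃ h₁ h₂ h₃
    simp only [Set.mem_ofPred_eq, vsub_eq_sub, vadd_eq_add, Pi.add_apply, Pi.smul_apply,
      Pi.sub_apply, smul_eq_mul] at *
    linear_combination c * h₁ - c * h₂ + h₃

open scoped Classical in
/-- The affinographic arrangement of a gain graph on `[n]`: all the hyperplanes
`x_j - x_i = g` in `ℝⁿ`, for the edges `(i, j)` with `i < j` and gain `g`. -/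
def arrangement {n : ℕ} (Φ : IntegralGainGraph (Fin n)) : Finset (AffineSubspace ℝ (Fin n → ℝ)) :=
  (Φ.edges.filter fun e => e.1 < e.2.1).image fun e => hyperplane e.1 e.2.1 e.2.2

/-- The gain graph `K_n^{ab}`: for all vertices `i < j` and all integers `g` with `a ≤ g ≤ b`,
there is an edge from `i` to `j` with gain `g`. -/
def K (n : ℕ) (a b : ℤ) : IntegralGainGraph (Fin n) where
  edges := (Finset.univ ×ˢ Finset.univ ×ˢ (Finset.Icc a b ∪ Finset.Icc (-b) (-a))).filter
    fun e => (e.1 < e.2.1 ∧ a ≤ e.2.2 ∧ e.2.2 ≤ b) ∨ (e.2.1 < e.1 ∧ a ≤ -e.2.2 ∧ -e.2.2 ≤ b)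
  symm := by
    intro i j g h
    simp only [Finset.mem_filter, Finset.mem_product, Finset.mem_univ, true_and,
      Finset.mem_union, Finset.mem_Icc] at *
    omega
  loopless := by
    intro i g h
    simp at h

end IntegralGainGraph

/-- The hyperplane `x_1 + ⋯ + x_n = 0` of `ℝⁿ`, as a linear subspace. -/
def zeroSum (n : ℕ) : Submodule ℝ (Fin n → ℝ) where
  carrier := {x | ∑ i, x i = 0}
  zero_mem' := by simp
  add_mem' := by
    intro x y hx hy
    simp only [Set.mem_ofPred_eq, Pi.add_apply, Finset.sum_add_distrib] at *
    rw [hx, hy, add_zero]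
  smul_mem' := by
    intro c x hx
    simp only [Set.mem_ofPred_eq, Pi.smul_apply, smul_eq_mul, ← Finset.mul_sum] at *
    rw [hx, mul_zero]

end

/-! The proof is Athanasiadis' counting method modulo a large `q`, not necessarily prime: `χ_A(q)`
is the number of proper colorings of the vertices by `ZMod q`. Möbius inversion (`eval_charPoly`)
only needs finitely many points that meet each flat `F` in `q ^ (dim F + k)` members. They come from
lifting colorings to integer vectors (`exists_int_lift`); those on a given flat form a coset of the
functions constant on the components of a graph. On `zeroSum` every flat loses one dimension, so `k
= 1`, and the same count is `q` times the value of `χ` there.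

For the count, rotate so that the last vertex has color 0 (a factor `q`). For gains in `[ε - b, b]`
with `ε = a + b ∈ {0, 1}`, properness means that vertices around the cycle keep distance `b + 1`, or
`b + 1 - ε` from a larger index to a smaller one. Deleting `b` places after each of the `N` vertices
(`compressEquiv`) reduces to gains in `[ε, 0]` modulo `q - bN`: no condition if `ε = 1`, distinct
colors if `ε = 0`. So the count is a power or a falling factorial, and polynomials agreeing at all
large `q` are equal. -/

namespace Arrangement

/-! ### Möbius inversion over the flats -/

variable {E : Type*} [AddCommGroup E] [Module ℝ E]

theorem mem_finset_inf (B : Finset (AffineSubspace ℝ E)) (p : E) :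
    p ∈ B.inf id ↔ ∀ H ∈ B, p ∈ H := by
  classical
  induction B using Finset.induction_on with
  | empty => simp
  | insert H B _ ih => simp [Finset.inf_insert, AffineSubspace.mem_inf_iff, ih]

theorem mem_flats (A : Finset (AffineSubspace ℝ E)) (F : AffineSubspace ℝ E) :
    F ∈ flats A ↔ (∃ B ⊆ A, B.inf id = F) ∧ F ≠ ⊥ := by
  simp [flats]

open scoped Classical in
/-- The smallest flat of `A` through a point. -/
theorem exists_flat_through (A : Finset (AffineSubspace ℝ E)) (hA : ⊤ ∉ A) (p : E) :
    ∃ G : IntersectionPoset A, (∀ F : IntersectionPoset A, p ∈ (OrderDual.ofDual F).1 ↔ F ≤ G) ∧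
      (whole A = G ↔ ∀ H ∈ A, p ∉ H) := by
  set G₀ := (A.filter fun H => p ∈ H).inf id with hG₀
  have hpG : p ∈ G₀ := (mem_finset_inf _ _).2 fun H hH => (Finset.mem_filter.1 hH).2
  have hG : G₀ ∈ flats A := by
    refine (mem_flats A G₀).2 ⟨⟨_, Finset.filter_subset _ _, rfl⟩, ?_⟩
    intro h
    rw [h] at hpG
    exact AffineSubspace.notMem_bot ℝ E p hpG
  refine ⟨OrderDual.toDual ⟨G₀, hG⟩, fun F => ⟨fun h => ?_, fun h => ?_⟩, fun h H hH hp => ?_,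
    fun h => ?_⟩
  · obtain ⟨⟨B, hB, hBF⟩, -⟩ := (mem_flats A _).1 (OrderDual.ofDual F).2
    change G₀ ≤ (OrderDual.ofDual F).1
    rw [← hBF] at h ⊢
    exact Finset.inf_mono fun H hH =>
      Finset.mem_filter.2 ⟨hB hH, (mem_finset_inf _ _).1 h H hH⟩
  · exact (show G₀ ≤ (OrderDual.ofDual F).1 from h) hpG
  · have h' : (⊤ : AffineSubspace ℝ E) = G₀ :=
      congrArg (fun F : IntersectionPoset A => (OrderDual.ofDual F).1) h
    have hle : G₀ ≤ H := Finset.inf_le (f := id) (Finset.mem_filter.2 ⟨hH, hp⟩)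
    rw [← h', top_le_iff] at hle
    exact hA (hle ▸ hH)
  · have : G₀ = ⊤ := by
      rw [hG₀, Finset.filter_false_of_mem h, Finset.inf_empty]
    exact congrArg OrderDual.toDual (Subtype.ext this.symm)

open scoped Classical in
/-- If a finite family of points meets every flat `F` of `A` in exactly `q ^ (dim F + k)` members,
then `q ^ k * χ_A(q)` of its members lie on no hyperplane of `A`. -/
theorem eval_charPoly (A : Finset (AffineSubspace ℝ E)) (hA : ⊤ ∉ A) {X : Type*} [Fintype X]
    (y : X → E) (q k : ℕ)
    (h : ∀ F ∈ flats A, (Finset.univ.filter fun x => y x ∈ F).card =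
      q ^ (Module.finrank ℝ F.direction + k)) :
    (q : ℤ) ^ k * (charPoly A).eval (q : ℤ) =
      ((Finset.univ.filter fun x => ∀ H ∈ A, y x ∉ H).card : ℤ) := by
  have key : ∀ p : E, (∑ F : IntersectionPoset A, if p ∈ (OrderDual.ofDual F).1 then
      IncidenceAlgebra.mu ℤ (whole A) F else 0) = if ∀ H ∈ A, p ∉ H then 1 else 0 := by
    intro p
    obtain ⟨G, hG, hG'⟩ := exists_flat_through A hA p
    rw [← Finset.sum_filter]
    -- The flats through `p` form the interval from the whole space to the smallest such flat `G`,
    -- over which `μ` sums to zero unless `G` is the whole space.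
    have : (Finset.univ.filter fun F : IntersectionPoset A => p ∈ (OrderDual.ofDual F).1) =
        Finset.Icc (whole A) G := by
      ext F
      rw [Finset.mem_filter, Finset.mem_Icc, hG]
      exact ⟨fun h => ⟨show (OrderDual.ofDual F).1 ≤ ⊤ from le_top, h.2⟩,
        fun h => ⟨Finset.mem_univ _, h.2⟩⟩
    rw [this, IncidenceAlgebra.sum_Icc_mu_right]
    simp only [hG']
  rw [charPoly, eval_finsetSum, Finset.mul_sum, Finset.card_filter, Nat.cast_sum]
  simp only [Nat.cast_ite, Nat.cast_one, Nat.cast_zero, ← key]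
  rw [Finset.sum_comm]
  refine Finset.sum_congr rfl fun F _ => ?_
  rw [← Finset.sum_filter, Finset.sum_const, h _ (OrderDual.ofDual F).2]
  simp only [eval_mul, eval_C, eval_pow, eval_X, nsmul_eq_mul, Nat.cast_pow]
  ring

end Arrangement

/-! ### Real and modular solutions of a flat's equations -/

/-- The functions constant on the classes of a relation, as functions on the quotient. -/
def quotFunEquiv {V : Type*} (r : V → V → Prop) (M : Type*) :
    {u : V → M // ∀ i j, r i j → u i = u j} ≃ (Quot r → M) where
  toFun u := Quot.lift u.1 u.2
  invFun f := ⟨fun i => f (Quot.mk r i), fun _ _ h => congrArg f (Quot.sound h)⟩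
  left_inv _ := rfl
  right_inv f := by
    funext i
    induction i using Quot.ind
    rfl

/-- The real functions constant on the classes of a relation. -/
def classFunctions {V : Type*} (r : V → V → Prop) : Submodule ℝ (V → ℝ) where
  carrier := {u | ∀ i j, r i j → u i = u j}
  zero_mem' := fun _ _ _ => rfl
  add_mem' := fun hu hv i j h => congrArg₂ (· + ·) (hu i j h) (hv i j h)
  smul_mem' := fun c _ hu i j h => congrArg (c * ·) (hu i j h)

theorem finrank_classFunctions {V : Type*} [Finite V] (r : V → V → Prop) :
    Module.finrank ℝ (classFunctions r) = Nat.card (Quot r) := by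
  have := Fintype.ofFinite (Quot r)
  let e : classFunctions r ≃ₗ[ℝ] (Quot r → ℝ) :=
    { quotFunEquiv r ℝ with
      map_add' := fun u v => by
        funext i
        induction i using Quot.ind
        rfl
      map_smul' := fun c u => by
        funext i
        induction i using Quot.ind
        rfl }
  rw [e.finrank_eq, Module.finrank_fintype_fun_eq_card, Nat.card_eq_fintype_card]

theorem card_functions_eq_pow {V : Type*} [Finite V] (r : V → V → Prop) (M : Type*) :
    Nat.card {u : V → M // ∀ i j, r i j → u i = u j} =
      Nat.card M ^ Nat.card (Quot r) := by
  rw [Nat.card_congr (quotFunEquiv r M), Nat.card_fun]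

/-- If `q > n m`, some `m` consecutive residues avoid `x`, and cutting the cycle there lifts `x`
to an integer vector whose small differences are those of `x`. -/
theorem exists_int_lift {n q m : ℕ} (hq : n * m < q) (x : Fin n → ZMod q) :
    ∃ w : Fin n → ℤ, ∀ i j : Fin n, ∀ g : ℤ, |g| ≤ m →
      (w j - w i = g ↔ x j - x i = (g : ZMod q)) := by
  have : NeZero q := ⟨by omega⟩
  obtain ⟨c, hc⟩ : ∃ c : ZMod q,
      c ∉ (Finset.univ : Finset (Fin n × Fin m)).image fun p => x p.1 - ((p.2 : ℕ) : ZMod q) := by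
    by_contra! h
    have h1 := Finset.card_le_card (fun c _ => h c :
      (Finset.univ : Finset (ZMod q)) ⊆ _)
    have h2 := h1.trans Finset.card_image_le
    simp only [Finset.card_univ, ZMod.card, Fintype.card_prod, Fintype.card_fin] at h2
    omega
  -- The representatives of `x i - c` lie in `[m, q)`, so a difference of two of them minus `g`
  -- stays below `q` in absolute value; a multiple of `q` there is zero.
  have hm : ∀ i, m ≤ (x i - c).val := by
    intro i
    by_contra! h
    refine hc (Finset.mem_image.2 ⟨(i, ⟨_, h⟩), Finset.mem_univ _, ?_⟩)
    simp
  have hlt : ∀ i, (x i - c).val < q := fun i => ZMod.val_lt _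
  have hcast : ∀ i, (((x i - c).val : ℤ) : ZMod q) = x i - c := fun i => by simp
  refine ⟨fun i => ((x i - c).val : ℤ), fun i j g hg => ⟨fun h => ?_, fun h => ?_⟩⟩
  · have := congrArg (Int.cast : ℤ → ZMod q) h
    rw [Int.cast_sub, hcast, hcast] at this
    rw [← this]
    ring
  · have h0 : (((((x j - c).val : ℤ) - ((x i - c).val : ℤ) - g : ℤ)) : ZMod q) = 0 := by
      rw [Int.cast_sub, Int.cast_sub, hcast, hcast, ← h]
      ring
    rw [ZMod.intCast_zmod_eq_zero_iff_dvd] at h0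
    have h1 := hm i
    have h2 := hm j
    have h3 := hlt i
    have h4 := hlt j
    have h5 := abs_le.1 hg
    have := Int.eq_zero_of_abs_lt_dvd h0 (by rw [abs_lt]; omega)
    exact sub_eq_zero.1 this

/-! ### Colorings modulo `q` and the characteristic polynomial -/

namespace IntegralGainGraph

variable {E : Type*} [AddCommGroup E] [Module ℝ E]

open scoped Classical in
/-- The arrangement of the pullbacks of the hyperplanes `x_j - x_i = g` along a linear map. -/
noncomputable def pullback {V : Type*} (S : Finset (V × V × ℤ)) (L : E →ₗ[ℝ] (V → ℝ)) :
    Finset (AffineSubspace ℝ E) :=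
  S.image fun s => (hyperplane s.1 s.2.1 s.2.2).comap L.toAffineMap

theorem exists_edges_of_mem_flats {V : Type*} (S : Finset (V × V × ℤ)) (L : E →ₗ[ℝ] (V → ℝ))
    {F : AffineSubspace ℝ E} (hF : F ∈ Arrangement.flats (pullback S L)) :
    ∃ T ⊆ S, (∀ v, v ∈ F ↔ ∀ s ∈ T, L v s.2.1 - L v s.1 = s.2.2) ∧ ∃ v, v ∈ F := by
  classical
  obtain ⟨⟨B, hB, rfl⟩, hne⟩ := (Arrangement.mem_flats _ _).1 hF
  refine ⟨S.filter fun s => (hyperplane s.1 s.2.1 s.2.2).comap L.toAffineMap ∈ B,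
    Finset.filter_subset _ _, fun v => ?_, ?_⟩
  · rw [Arrangement.mem_finset_inf]
    constructor
    · intro h s hs
      exact h _ (Finset.mem_filter.1 hs).2
    · intro h H hH
      obtain ⟨s, hs, rfl⟩ := Finset.mem_image.1 (hB hH)
      exact h s (Finset.mem_filter.2 ⟨hs, hH⟩)
  · exact (AffineSubspace.nonempty_iff_ne_bot _).2 hne

open scoped Classical in
/-- The value of the characteristic polynomial at a large `q` counts proper colorings modulo `q`. -/
theorem eval_charPoly_pullback {n : ℕ} (S : Finset (Fin n × Fin n × ℤ)) (m q k : ℕ)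
    (hS : ∀ s ∈ S, s.1 ≠ s.2.1 ∧ |s.2.2| ≤ m) (hq : n * m < q) (L : E →ₗ[ℝ] (Fin n → ℝ))
    (hdim : ∀ D : Submodule ℝ (Fin n → ℝ), (∀ c : ℝ, (fun _ => c) ∈ D) →
      Module.finrank ℝ (D.comap L) + k = Module.finrank ℝ D)
    (hsurj : ∀ y : Fin n → ℝ, ∃ v : E, ∀ i j, L v j - L v i = y j - y i) :
    (q : ℤ) ^ k * (Arrangement.charPoly (pullback S L)).eval (q : ℤ) =
      (Nat.card {x : Fin n → ZMod q // ∀ s ∈ S, x s.2.1 - x s.1 ≠ (s.2.2 : ZMod q)} : ℤ) := by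
  have : NeZero q := ⟨by omega⟩
  choose w hw using fun x : Fin n → ZMod q => exists_int_lift hq x
  choose π hπ using hsurj
  set y : (Fin n → ZMod q) → E := fun x => π fun i => (w x i : ℝ) with hy
  have hyS : ∀ x, ∀ s ∈ S, L (y x) s.2.1 - L (y x) s.1 = s.2.2 ↔
      x s.2.1 - x s.1 = (s.2.2 : ZMod q) := by
    intro x s hs
    rw [hy, hπ, ← hw x _ _ _ (hS s hs).2]
    norm_cast
  have htop : ⊤ ∉ pullback S L := by
    intro h
    obtain ⟨s, hs, h⟩ := Finset.mem_image.1 h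
    have h1 : π (Pi.single s.2.1 (s.2.2 + 1 : ℝ)) ∈ (⊤ : AffineSubspace ℝ E) :=
      AffineSubspace.mem_top ℝ E _
    rw [← h] at h1
    have h2 : L (π (Pi.single s.2.1 (s.2.2 + 1 : ℝ))) s.2.1 -
      L (π (Pi.single s.2.1 (s.2.2 + 1 : ℝ))) s.1 = s.2.2 := h1
    rw [hπ, Pi.single_eq_same, Pi.single_eq_of_ne (hS s hs).1] at h2
    linarith
  rw [Arrangement.eval_charPoly (pullback S L) htop y q k, Nat.card_eq_fintype_card,
    Fintype.card_subtype]
  · congr 2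
    ext x
    simp only [Finset.mem_filter, Finset.mem_univ, true_and, pullback, Finset.forall_mem_image]
    exact forall₂_congr fun s hs => not_congr (hyS x s hs)
  · intro F hF
    obtain ⟨T, hTS, hT, v₀, hv₀⟩ := exists_edges_of_mem_flats S L hF
    -- The homogeneous equations of `F` say that coordinates agree along the edges in `T`; its
    -- dimension is thus governed by the number of components.
    set r : Fin n → Fin n → Prop := fun i j => ∃ g, (i, j, g) ∈ T with hr
    have hdir : F.direction = (classFunctions r).comap L := by
      ext d
      rw [← AffineSubspace.vadd_mem_iff_mem_direction d hv₀, hT]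
      have h0 := (hT v₀).1 hv₀
      simp only [vadd_eq_add, map_add, Pi.add_apply]
      constructor
      · rintro h i j ⟨g, hg⟩
        have h1 := h _ hg
        have h2 := h0 _ hg
        simp only at h1 h2
        linarith
      · intro h s hs
        have h1 : L d s.1 = L d s.2.1 := h s.1 s.2.1 ⟨s.2.2, hs⟩
        have h2 := h0 s hs
        linarith
    have hfin : Module.finrank ℝ F.direction + k = Nat.card (Quot r) := by
      rw [hdir, hdim, finrank_classFunctions]
      exact fun c i j _ => rfl
    -- A solution modulo `q`: integer differences of the coordinates of `v₀` survive rounding down.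
    -- Subtracting `z` makes the equations homogeneous.
    set z : Fin n → ZMod q := fun i => ((⌊L v₀ i⌋ : ℤ) : ZMod q) with hz
    have hz' : ∀ s ∈ T, z s.2.1 - z s.1 = (s.2.2 : ZMod q) := by
      intro s hs
      have h2 : L v₀ s.2.1 = L v₀ s.1 + (s.2.2 : ℤ) := by
        have := (hT v₀).1 hv₀ s hs
        linarith
      simp only [hz, h2, Int.floor_add_intCast]
      push_cast
      ring
    have e : {x // y x ∈ F} ≃ {u : Fin n → ZMod q // ∀ i j, r i j → u i = u j} :=
      (Equiv.subRight z).subtypeEquiv fun x => by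
        rw [hT]
        constructor
        · rintro h i j ⟨g, hg⟩
          have h1 := (hyS x _ (hTS hg)).1 (h _ hg)
          have h2 := hz' _ hg
          simp only [Equiv.subRight_apply, Pi.sub_apply] at h1 h2 ⊢
          linear_combination h2 - h1
        · intro h s hs
          have h1 := h s.1 s.2.1 ⟨s.2.2, hs⟩
          have h2 := hz' s hs
          rw [hyS x s (hTS hs)]
          simp only [Equiv.subRight_apply, Pi.sub_apply] at h1
          linear_combination h2 - h1
    rw [hfin, ← Fintype.card_subtype, ← Nat.card_eq_fintype_card, Nat.card_congr e,
      card_functions_eq_pow, Nat.card_zmod]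

end IntegralGainGraph

/-! ### The graphs `K n a b`, in the full space and on `zeroSum` -/

namespace IntegralGainGraph

/-- A proper coloring modulo `q` of the gain graph `K n a b`. -/
def IsModColoring {n : ℕ} (q : ℕ) (a b : ℤ) (x : Fin n → ZMod q) : Prop :=
  ∀ i j, i < j → ∀ g : ℤ, a ≤ g → g ≤ b → x j - x i ≠ (g : ZMod q)

variable {n : ℕ}

theorem mem_edges_K {a b : ℤ} {i j : Fin n} (hij : i < j) (g : ℤ) :
    (i, j, g) ∈ (K n a b).edges ↔ a ≤ g ∧ g ≤ b := by
  simp only [K, Finset.mem_filter, Finset.mem_product, Finset.mem_univ, true_and,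
    Finset.mem_union, Finset.mem_Icc]
  have := hij.not_gt
  tauto

open scoped Classical in
theorem arrangement_eq_pullback (Φ : IntegralGainGraph (Fin n)) :
    Φ.arrangement = pullback (Φ.edges.filter fun e => e.1 < e.2.1) LinearMap.id :=
  Finset.image_congr fun _ _ => rfl

open scoped Classical in
theorem restrict_arrangement_eq_pullback (Φ : IntegralGainGraph (Fin n))
    (W : Submodule ℝ (Fin n → ℝ)) :
    Arrangement.restrict Φ.arrangement W =
      pullback (Φ.edges.filter fun e => e.1 < e.2.1) W.subtype := by
  rw [Arrangement.restrict, arrangement, Finset.image_image]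
  rfl

/-- Here `k` is the dimension lost by passing to `E`: 0 for the identity, 1 for the inclusion of
`zeroSum`. -/
theorem eval_charPoly_pullback_K {E : Type*} [AddCommGroup E] [Module ℝ E] {a b : ℤ} (m q k : ℕ)
    (ha : -m ≤ a) (hb : b ≤ m) (hq : n * m < q) (L : E →ₗ[ℝ] (Fin n → ℝ))
    (hdim : ∀ D : Submodule ℝ (Fin n → ℝ), (∀ c : ℝ, (fun _ => c) ∈ D) →
      Module.finrank ℝ (D.comap L) + k = Module.finrank ℝ D)
    (hsurj : ∀ y : Fin n → ℝ, ∃ v : E, ∀ i j, L v j - L v i = y j - y i) :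
    (q : ℤ) ^ k * (Arrangement.charPoly
      (pullback ((K n a b).edges.filter fun e => e.1 < e.2.1) L)).eval (q : ℤ) =
      (Nat.card {x : Fin n → ZMod q // IsModColoring q a b x} : ℤ) := by
  rw [eval_charPoly_pullback _ m q k _ hq L hdim hsurj]
  · congr 1
    refine Nat.card_congr (Equiv.subtypeEquivRight fun x => ?_)
    constructor
    · intro h i j hij g hg hg'
      exact h (i, j, g) (Finset.mem_filter.2 ⟨(mem_edges_K hij g).2 ⟨hg, hg'⟩, hij⟩)
    · rintro h ⟨i, j, g⟩ hs
      obtain ⟨hs, hij⟩ := Finset.mem_filter.1 hs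
      obtain ⟨hg, hg'⟩ := (mem_edges_K hij g).1 hs
      exact h i j hij g hg hg'
  · rintro ⟨i, j, g⟩ hs
    obtain ⟨hs, hij⟩ := Finset.mem_filter.1 hs
    obtain ⟨hg, hg'⟩ := (mem_edges_K hij g).1 hs
    exact ⟨ne_of_lt hij, abs_le.2 ⟨by simp only; omega, by simp only; omega⟩⟩

theorem eval_charPoly_K {a b : ℤ} (m q : ℕ) (ha : -m ≤ a) (hb : b ≤ m) (hq : n * m < q) :
    (Arrangement.charPoly (K n a b).arrangement).eval (q : ℤ) =
      (Nat.card {x : Fin n → ZMod q // IsModColoring q a b x} : ℤ) := by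
  rw [arrangement_eq_pullback, ← eval_charPoly_pullback_K m q 0 ha hb hq LinearMap.id, pow_zero,
    one_mul]
  · intro D _
    rw [Submodule.comap_id, add_zero]
  · exact fun y => ⟨y, fun i j => rfl⟩

/-- The coordinate sum is onto already on the constant vectors in `D`, and its kernel on `D` is `D ∩
zeroSum`. -/
theorem finrank_comap_zeroSum (hn : 1 ≤ n) (D : Submodule ℝ (Fin n → ℝ))
    (hD : ∀ c : ℝ, (fun _ => c) ∈ D) :
    Module.finrank ℝ (D.comap (zeroSum n).subtype) + 1 = Module.finrank ℝ D := by
  let f : D →ₗ[ℝ] ℝ := (∑ i, LinearMap.proj i : (Fin n → ℝ) →ₗ[ℝ] ℝ) ∘ₗ D.subtype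
  have hf : ∀ u : D, f u = ∑ i, u.1 i := fun u => by
    simp [f]
  have hsurj : LinearMap.range f = ⊤ := by
    refine LinearMap.range_eq_top.2 fun c => ⟨⟨_, hD (c / n)⟩, ?_⟩
    rw [hf]
    have : (n : ℝ) ≠ 0 := by positivity
    simp only [Finset.sum_const, Finset.card_univ, Fintype.card_fin, nsmul_eq_mul]
    field_simp
  have hker : LinearMap.ker f = (zeroSum n).comap D.subtype := by
    ext u
    rw [LinearMap.mem_ker, hf]
    rfl
  rw [← LinearMap.finrank_range_add_finrank_ker f, hsurj, hker, finrank_top, Module.finrank_self,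
    ← Submodule.finrank_map_subtype_eq, ← Submodule.finrank_map_subtype_eq D,
    Submodule.map_comap_subtype, Submodule.map_comap_subtype, inf_comm, add_comm]

theorem mul_eval_charPoly_restrict_K (hn : 1 ≤ n) {a b : ℤ} (m q : ℕ) (ha : -m ≤ a) (hb : b ≤ m)
    (hq : n * m < q) :
    (q : ℤ) * (Arrangement.charPoly
      (Arrangement.restrict (K n a b).arrangement (zeroSum n))).eval (q : ℤ) =
      (Nat.card {x : Fin n → ZMod q // IsModColoring q a b x} : ℤ) := by
  rw [restrict_arrangement_eq_pullback,
    ← eval_charPoly_pullback_K m q 1 ha hb hq (zeroSum n).subtype, pow_one]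
  · exact finrank_comap_zeroSum hn
  · intro y
    refine ⟨⟨fun i => y i - (∑ l, y l) / n, ?_⟩, fun i j => ?_⟩
    · change ∑ i, (y i - (∑ l, y l) / n) = 0
      have : (n : ℝ) ≠ 0 := by positivity
      simp only [Finset.sum_sub_distrib, Finset.sum_const, Finset.card_univ, Fintype.card_fin,
        nsmul_eq_mul]
      field_simp
      ring
    · simp

end IntegralGainGraph

/-! ### Spaced integer vectors and their compression -/

namespace IntegralGainGraph

/-- The strict order of the indices by value, ties being broken in favour of the larger index. -/
def Before {n : ℕ} (w : Fin n → ℤ) (i j : Fin n) : Prop :=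
  w i < w j ∨ w i = w j ∧ j < i

namespace Before

variable {n : ℕ} {w : Fin n → ℤ} {i j k : Fin n}

theorem irrefl (w : Fin n → ℤ) (i : Fin n) : ¬ Before w i i := by
  simp [Before]

theorem trans (h : Before w i j) (h' : Before w j k) : Before w i k := by
  unfold Before at *
  omega

theorem asymm (h : Before w i j) : ¬ Before w j i := fun h' => irrefl w i (h.trans h')

theorem total (h : i ≠ j) : Before w i j ∨ Before w j i := by
  unfold Before
  omega

end Before

/-- Both relations are strict total orders, so neither can properly contain the other. -/
theorem before_congr {n : ℕ} {w w' : Fin n → ℤ} (h : ∀ i j, Before w i j → Before w' i j) :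
    Before w' = Before w := by
  funext i j
  refine propext ⟨fun hij => ?_, h i j⟩
  by_contra hn
  rcases eq_or_ne i j with rfl | hne
  · exact Before.irrefl _ _ hij
  · exact (h j i ((Before.total hne).resolve_left hn)).asymm hij

open scoped Classical in
/-- The position of `i`, counted from `0`, in the order `Before w`. -/
noncomputable def rank {n : ℕ} (w : Fin n → ℤ) (i : Fin n) : ℕ :=
  (Finset.univ.filter fun k => Before w k i).card

section rank

variable {n : ℕ} {w w' : Fin n → ℤ} {i j : Fin n}

theorem rank_congr (h : Before w' = Before w) : rank w' = rank w := by
  funext i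
  rw [rank, rank, h]

theorem rank_lt_rank (h : Before w i j) : rank w i < rank w j := by
  classical
  refine Finset.card_lt_card (Finset.ssubset_iff_of_subset ?_ |>.2 ⟨i, ?_, ?_⟩)
  · intro k hk
    simp only [Finset.mem_filter, Finset.mem_univ, true_and] at hk ⊢
    exact hk.trans h
  · simpa using h
  · simpa using Before.irrefl w i

theorem rank_le_succ (h : ∀ k, ¬ (Before w i k ∧ Before w k j)) : rank w j ≤ rank w i + 1 := by
  classical
  refine (Finset.card_le_card fun k hk => ?_).trans (Finset.card_insert_le i _)
  simp only [Finset.mem_insert, Finset.mem_filter, Finset.mem_univ, true_and] at hk ⊢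
  by_contra! hc
  exact h k ⟨(Before.total hc.1).resolve_left hc.2, hk⟩

theorem rank_lt (w : Fin n → ℤ) (i : Fin n) : rank w i < n := by
  classical
  have : rank w i < Fintype.card (Fin n) :=
    Finset.card_lt_univ_of_notMem (x := i) (by simpa using Before.irrefl w i)
  rwa [Fintype.card_fin] at this

theorem exists_last (w : Fin (n + 1) → ℤ) :
    ∃ M, rank w M = n ∧ ∀ i, i ≠ M → Before w i M := by
  classical
  obtain ⟨M, -, hM⟩ := Finset.exists_max_image Finset.univ (rank w) Finset.univ_nonempty
  have h : ∀ i, i ≠ M → Before w i M := fun i hi =>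
    (Before.total hi).resolve_right fun h => (rank_lt_rank h).not_ge (hM i (Finset.mem_univ i))
  refine ⟨M, ?_, h⟩
  have : (Finset.univ.filter fun k => Before w k M) = Finset.univ.erase M := by
    ext k
    simp only [Finset.mem_filter, Finset.mem_univ, true_and, Finset.mem_erase, and_true]
    exact ⟨fun hk hkM => Before.irrefl w M (hkM ▸ hk), h k⟩
  rw [rank, this, Finset.card_erase_of_mem (Finset.mem_univ M), Finset.card_univ,
    Fintype.card_fin, Nat.add_sub_cancel]

end rank

/-- The least distance that an index `i` must keep from a later index `j`, up to a constant. -/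
def gap {n : ℕ} (ε : ℤ) (i j : Fin n) : ℤ := if i < j then 1 else 1 - ε

/-- Every two values have the distance required of a proper coloring with gains in
`[ε - b, b]`. -/
def IsSpaced {n : ℕ} (ε b : ℤ) (w : Fin n → ℤ) : Prop :=
  ∀ i j, Before w i j → b + gap ε i j ≤ w j - w i

section spaced

variable {n : ℕ} {ε b : ℤ} {w : Fin n → ℤ}

theorem gap_nonneg (h1 : ε ≤ 1) (i j : Fin n) : 0 ≤ gap ε i j := by
  unfold gap
  split_ifs <;> omega

/-- If `i < j`, then `i < k` or `k < j`, so one of the two gaps on the right is already 1. -/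
theorem gap_triangle (h0 : 0 ≤ ε) (h1 : ε ≤ 1) (i j k : Fin n) :
    gap ε i j ≤ gap ε i k + gap ε k j := by
  unfold gap
  split_ifs <;> omega

/-- A zero gap occurs only from a larger index to a smaller one, which is how `Before` breaks ties.
-/
theorem before_of_gap_le (h1 : ε ≤ 1) {i j : Fin n} (hij : i ≠ j) (h : gap ε i j ≤ w j - w i) :
    Before w i j := by
  unfold gap at h
  unfold Before
  split_ifs at h <;> omega

/-- Add up the spacing along the consecutive vertices from `i` to `j`: each step contributes `b`,
and the gaps combine by `gap_triangle`. -/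
theorem IsSpaced.rank_mul_le (h0 : 0 ≤ ε) (h1 : ε ≤ 1) (h : IsSpaced ε b w)
    (d : ℕ) : ∀ i j, Before w i j → rank w j ≤ rank w i + d →
      b * ((rank w j : ℤ) - rank w i) + gap ε i j ≤ w j - w i := by
  induction d using Nat.strong_induction_on with
  | _ d ih =>
    intro i j hij hd
    by_cases hk : ∃ k, Before w i k ∧ Before w k j
    · obtain ⟨k, hik, hkj⟩ := hk
      have r1 := rank_lt_rank hik
      have r2 := rank_lt_rank hkj
      have e1 := ih (rank w k - rank w i) (by omega) i k hik (by omega)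
      have e2 := ih (rank w j - rank w k) (by omega) k j hkj (by omega)
      have := gap_triangle h0 h1 i j k
      linarith
    · push Not at hk
      have r1 := rank_le_succ fun k hk' => hk k hk'.1 hk'.2
      have r2 := rank_lt_rank hij
      have : (rank w j : ℤ) - rank w i = 1 := by omega
      rw [this, mul_one]
      exact h i j hij

/-- The order, hence the rank, is unchanged, which is what makes compression and expansion mutually
inverse. -/
theorem IsSpaced.compress (h0 : 0 ≤ ε) (h1 : ε ≤ 1) (h : IsSpaced ε b w) :
    (Before fun i => w i - b * rank w i) = Before w ∧
      IsSpaced ε 0 fun i => w i - b * rank w i := by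
  have key : ∀ i j, Before w i j →
      gap ε i j ≤ (w j - b * rank w j) - (w i - b * rank w i) := fun i j hij => by
    have := h.rank_mul_le h0 h1 _ i j hij le_add_self
    linarith
  have hB : (Before fun i => w i - b * rank w i) = Before w :=
    before_congr fun i j hij => before_of_gap_le h1
      (fun he => Before.irrefl w j (he ▸ hij)) (key i j hij)
  refine ⟨hB, fun i j hij => ?_⟩
  rw [hB] at hij
  rw [zero_add]
  exact key i j hij

theorem IsSpaced.expand (h1 : ε ≤ 1) (h : IsSpaced ε 0 w) (hb : 0 ≤ b) :
    (Before fun i => w i + b * rank w i) = Before w ∧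
      IsSpaced ε b fun i => w i + b * rank w i := by
  have key : ∀ i j, Before w i j →
      b + gap ε i j ≤ (w j + b * rank w j) - (w i + b * rank w i) := fun i j hij => by
    have r : (rank w i : ℤ) + 1 ≤ rank w j := by exact_mod_cast rank_lt_rank hij
    have := mul_le_mul_of_nonneg_left r hb
    have := h i j hij
    linarith
  have hB : (Before fun i => w i + b * rank w i) = Before w :=
    before_congr fun i j hij => before_of_gap_le h1
      (fun he => Before.irrefl w j (he ▸ hij)) (by have := key i j hij; linarith)
  refine ⟨hB, fun i j hij => ?_⟩
  rw [hB] at hij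
  exact key i j hij

end spaced

/-- The integer representatives of the proper colorings modulo `q` that vanish at the last
vertex. -/
structure IsRepresentative {n : ℕ} (ε b : ℤ) (q : ℤ) (w : Fin (n + 1) → ℤ) : Prop where
  last : w (Fin.last n) = 0
  nonneg : ∀ i, 0 ≤ w i
  le : ∀ i, w i ≤ q - b - 1
  spaced : IsSpaced ε b w

section representative

variable {n : ℕ} {ε b q : ℤ} {w : Fin (n + 1) → ℤ}

theorem IsRepresentative.last_before (h : IsRepresentative ε b q w) {i : Fin (n + 1)}
    (hi : i ≠ Fin.last n) : Before w (Fin.last n) i := by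
  have h1 := h.last
  have h2 := h.nonneg i
  have h3 := Fin.lt_last_iff_ne_last.2 hi
  unfold Before
  omega

theorem IsRepresentative.rank_last (h : IsRepresentative ε b q w) :
    rank w (Fin.last n) = 0 := by
  classical
  rw [rank, Finset.card_eq_zero, Finset.filter_eq_empty_iff]
  intro k _ hk
  rcases eq_or_ne k (Fin.last n) with rfl | hne
  · exact Before.irrefl _ _ hk
  · exact hk.asymm (h.last_before hne)

/-- The greatest vertex has rank `n` and moves down by `b * n`; one more `b` is the room between it
and the return to 0 around the cycle. -/
theorem IsRepresentative.compress (h0 : 0 ≤ ε) (h1 : ε ≤ 1)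
    (h : IsRepresentative ε b q w) :
    IsRepresentative ε 0 (q - b * (n + 1)) fun i => w i - b * rank w i where
  last := by simp [h.last, h.rank_last]
  nonneg i := by
    rcases eq_or_ne i (Fin.last n) with rfl | hne
    · simp [h.last, h.rank_last]
    · have := h.spaced.rank_mul_le h0 h1 _ _ _ (h.last_before hne) le_add_self
      rw [h.rank_last, h.last] at this
      have := gap_nonneg h1 (Fin.last n) i
      push_cast at *
      linarith
  le i := by
    obtain ⟨M, hM, hM'⟩ := exists_last w
    have h2 := h.le M
    rcases eq_or_ne i M with rfl | hne
    · rw [hM]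
      linarith
    · have := h.spaced.rank_mul_le h0 h1 _ _ _ (hM' i hne) le_add_self
      have := gap_nonneg h1 i M
      rw [hM] at *
      linarith
  spaced := (h.spaced.compress h0 h1).2

theorem IsRepresentative.expand (h1 : ε ≤ 1) (hb : 0 ≤ b)
    (h : IsRepresentative ε 0 (q - b * (n + 1)) w) :
    IsRepresentative ε b q fun i => w i + b * rank w i where
  last := by simp [h.last, h.rank_last]
  nonneg i := add_nonneg (h.nonneg i) (mul_nonneg hb (Nat.cast_nonneg _))
  le i := by
    have h2 := h.le i
    have r : (rank w i : ℤ) ≤ n := by exact_mod_cast Nat.lt_succ_iff.1 (rank_lt w i)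
    have := mul_le_mul_of_nonneg_left r hb
    linarith
  spaced := (h.spaced.expand h1 hb).2

/-- Removing `b` empty places after each vertex. -/
noncomputable def compressEquiv (h0 : 0 ≤ ε) (h1 : ε ≤ 1) (hb : 0 ≤ b) :
    {w : Fin (n + 1) → ℤ // IsRepresentative ε b q w} ≃
      {w : Fin (n + 1) → ℤ // IsRepresentative ε 0 (q - b * (n + 1)) w} where
  toFun w := ⟨_, w.2.compress h0 h1⟩
  invFun w := ⟨_, w.2.expand h1 hb⟩
  left_inv w := by
    ext i
    simp only [rank_congr (w.2.spaced.compress h0 h1).1]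
    ring
  right_inv w := by
    ext i
    simp only [rank_congr (w.2.spaced.expand h1 hb).1]
    ring

end representative

/-- For integer representatives in `[0, q)` that vanish at the last vertex, proper colorings are
the spaced vectors that end before `q - b`. -/
theorem isModColoring_iff {n q : ℕ} {ε b : ℤ} (h0 : 0 ≤ ε) (h1 : ε ≤ 1) (hb : 0 ≤ b)
    (hbq : b < q) (w : Fin (n + 1) → ℤ) (hlast : w (Fin.last n) = 0) (hw : ∀ i, 0 ≤ w i)
    (hwq : ∀ i, w i < q) :
    IsModColoring q (ε - b) b (fun i => (w i : ZMod q)) ↔ IsRepresentative ε b q w := by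
  constructor
  · intro h
    refine ⟨hlast, hw, fun i => ?_, fun i j hij => ?_⟩
    · rcases eq_or_ne i (Fin.last n) with rfl | hne
      · omega
      · by_contra! hc
        -- Going on from `w i` around the cycle reaches the last vertex, at 0, after `q - w i ≤ b`
        -- places: a forbidden gain.
        refine h i (Fin.last n) (Fin.lt_last_iff_ne_last.2 hne) (q - w i) ?_ ?_ ?_
        · have := hwq i
          omega
        · omega
        · simp [hlast]
    · by_contra! hc
      unfold gap at hc
      unfold Before at hij
      rcases lt_trichotomy i j with hlt | rfl | hlt
      · rw [if_pos hlt] at hc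
        exact h i j hlt (w j - w i) (by omega) (by omega) (by push_cast; rfl)
      · omega
      · rw [if_neg hlt.not_gt] at hc
        exact h j i hlt (w i - w j) (by omega) (by omega) (by push_cast; rfl)
  · intro h i j hij g hg hg' he
    have hd : ((w j - w i - g : ℤ) : ZMod q) = 0 := by
      push_cast
      rw [he, sub_self]
    rw [ZMod.intCast_zmod_eq_zero_iff_dvd] at hd
    have hi := h.nonneg i
    have hj := h.nonneg j
    have hi' := h.le i
    have hj' := h.le j
    -- The bound `q - b - 1` on the values excludes wrap-around; spacing puts `w j - w i` above `b`
    -- or below `ε - b`.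
    have hs : |w j - w i - g| < q ∧ w j - w i - g ≠ 0 := by
      rw [abs_lt]
      rcases Before.total (w := w) hij.ne with hB | hB
      · have := h.spaced i j hB
        rw [gap, if_pos hij] at this
        omega
      · have := h.spaced j i hB
        rw [gap, if_neg hij.not_gt] at this
        omega
    exact hs.2 (Int.eq_zero_of_abs_lt_dvd hd hs.1)

end IntegralGainGraph

/-! ### Counting colorings and comparing polynomials -/

namespace IntegralGainGraph

theorem IsModColoring.sub_const {n q : ℕ} {a b : ℤ} {x : Fin n → ZMod q}
    (h : IsModColoring q a b x) (c : ZMod q) : IsModColoring q a b fun i => x i - c := by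
  intro i j hij g hg hg'
  simp only [sub_sub_sub_cancel_right]
  exact h i j hij g hg hg'

/-- Rotating a coloring so that the vertex `l` gets the color `0`. -/
def rotateEquiv {n : ℕ} (q : ℕ) (a b : ℤ) (l : Fin n) :
    {x : Fin n → ZMod q // IsModColoring q a b x} ≃
      ZMod q × {x : Fin n → ZMod q // IsModColoring q a b x ∧ x l = 0} where
  toFun x := (x.1 l, ⟨fun i => x.1 i - x.1 l, x.2.sub_const _, sub_self _⟩)
  invFun p := ⟨fun i => p.2.1 i - -p.1, p.2.2.1.sub_const _⟩
  left_inv x := by ext i; simp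
  right_inv p := by ext <;> simp [p.2.2.2]

/-- Proper colorings modulo `q` vanishing at the last vertex as integer vectors. -/
def representativeEquiv {n q : ℕ} {ε b : ℤ} (h0 : 0 ≤ ε) (h1 : ε ≤ 1) (hb : 0 ≤ b)
    (hbq : b < q) :
    {x : Fin (n + 1) → ZMod q // IsModColoring q (ε - b) b x ∧ x (Fin.last n) = 0} ≃
      {w : Fin (n + 1) → ℤ // IsRepresentative ε b q w} where
  toFun x := ⟨fun i => (x.1 i).val, by
    have : NeZero q := ⟨by omega⟩
    refine (isModColoring_iff h0 h1 hb hbq _ (by simp [x.2.2]) (fun i => by positivity)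
      fun i => by exact_mod_cast ZMod.val_lt _).1 ?_
    simpa using x.2.1⟩
  invFun w := ⟨fun i => (w.1 i : ZMod q),
    (isModColoring_iff h0 h1 hb hbq _ w.2.last w.2.nonneg fun i => by
      have := w.2.le i
      omega).2 w.2, by simp [w.2.last]⟩
  left_inv x := by
    have : NeZero q := ⟨by omega⟩
    ext i
    simp
  right_inv w := by
    have : NeZero q := ⟨by omega⟩
    ext i
    simp only [ZMod.val_intCast]
    have := w.2.le i
    exact Int.emod_eq_of_lt (w.2.nonneg i) (by omega)

theorem card_isModColoring {n q : ℕ} {ε b : ℤ} (h0 : 0 ≤ ε) (h1 : ε ≤ 1) (hb : 0 ≤ b)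
    (hbq : b < q) :
    Nat.card {x : Fin (n + 1) → ZMod q // IsModColoring q (ε - b) b x} =
      q * Nat.card {w : Fin (n + 1) → ℤ // IsRepresentative ε b q w} := by
  rw [Nat.card_congr (rotateEquiv q (ε - b) b (Fin.last n)), Nat.card_prod, Nat.card_zmod,
    Nat.card_congr (representativeEquiv h0 h1 hb hbq)]

theorem card_isModColoring_one_zero (n q : ℕ) :
    Nat.card {x : Fin n → ZMod q // IsModColoring q 1 0 x} = q ^ n := by
  have h : ∀ x : Fin n → ZMod q, IsModColoring q 1 0 x := fun x i j _ g hg hg' => by omega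
  rw [Nat.card_congr (Equiv.subtypeUnivEquiv h), Nat.card_fun, Nat.card_zmod,
    Nat.card_eq_fintype_card, Fintype.card_fin]

theorem isModColoring_zero_zero_iff {n q : ℕ} (x : Fin n → ZMod q) :
    IsModColoring q 0 0 x ↔ Function.Injective x := by
  constructor
  · intro h i j hij
    by_contra hne
    rcases lt_or_gt_of_ne hne with hlt | hlt
    · exact h i j hlt 0 le_rfl le_rfl (by simp [hij])
    · exact h j i hlt 0 le_rfl le_rfl (by simp [hij])
  · intro h i j hij g hg hg' he
    obtain rfl : g = 0 := le_antisymm hg' hg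
    rw [Int.cast_zero, sub_eq_zero] at he
    exact hij.ne' (h he)

theorem card_isModColoring_zero_zero (n q : ℕ) [NeZero q] :
    Nat.card {x : Fin n → ZMod q // IsModColoring q 0 0 x} = q.descFactorial n := by
  rw [Nat.card_congr ((Equiv.subtypeEquivRight isModColoring_zero_zero_iff).trans
    (Equiv.subtypeInjectiveEquivEmbedding _ _)), Nat.card_eq_fintype_card,
    Fintype.card_embedding_eq, ZMod.card, Fintype.card_fin]

/-- The number of representatives for gains in `[ε - b, b]` modulo `q` is the number of proper
colorings for gains in `[ε, 0]` modulo `q - b n`, divided by `q - b n`. -/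
theorem mul_card_isRepresentative {n q q' : ℕ} {ε b : ℤ} (h0 : 0 ≤ ε) (h1 : ε ≤ 1) (hb : 0 ≤ b)
    (hq' : (q' : ℤ) = q - b * (n + 1)) (hpos : 0 < q') :
    q' * Nat.card {w : Fin (n + 1) → ℤ // IsRepresentative ε b q w} =
      Nat.card {x : Fin (n + 1) → ZMod q' // IsModColoring q' ε 0 x} := by
  have := card_isModColoring (n := n) (q := q') h0 h1 le_rfl (by exact_mod_cast hpos)
  rw [sub_zero] at this
  rw [this, Nat.card_congr (compressEquiv h0 h1 hb), hq']

theorem card_isRepresentative_one {n q q' : ℕ} {b : ℤ} (hb : 0 ≤ b)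
    (hq' : (q' : ℤ) = q - b * (n + 1)) (hpos : 0 < q') :
    Nat.card {w : Fin (n + 1) → ℤ // IsRepresentative 1 b q w} = q' ^ n := by
  have := mul_card_isRepresentative (n := n) zero_le_one le_rfl hb hq' hpos
  rw [card_isModColoring_one_zero, pow_succ'] at this
  exact Nat.eq_of_mul_eq_mul_left hpos this

theorem card_isRepresentative_zero {n q q' : ℕ} {b : ℤ} (hb : 0 ≤ b)
    (hq' : (q' : ℤ) + 1 = q - b * (n + 1)) :
    Nat.card {w : Fin (n + 1) → ℤ // IsRepresentative 0 b q w} = q'.descFactorial n := by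
  have := mul_card_isRepresentative (n := n) (q' := q' + 1) le_rfl zero_le_one hb
    (by exact_mod_cast hq') q'.succ_pos
  rw [card_isModColoring_zero_zero, Nat.succ_descFactorial_succ] at this
  exact Nat.eq_of_mul_eq_mul_left q'.succ_pos this

/-- A polynomial whose values at all large `q` are the numbers of representatives is the
characteristic polynomial of the induced arrangement, and `X` times it is that of the
arrangement. -/
theorem charPoly_K_of_eval {n : ℕ} {ε b : ℤ} (h0 : 0 ≤ ε) (h1 : ε ≤ 1) (hb : 0 ≤ b)
    (P : ℤ[X]) (Q : ℕ) (hP : ∀ q : ℕ, Q ≤ q →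
      P.eval (q : ℤ) = Nat.card {w : Fin (n + 1) → ℤ // IsRepresentative ε b q w}) :
    Arrangement.charPoly (Arrangement.restrict (K (n + 1) (ε - b) b).arrangement
      (zeroSum (n + 1))) = P ∧
    Arrangement.charPoly (K (n + 1) (ε - b) b).arrangement = X * P := by
  obtain ⟨m, rfl⟩ := Int.eq_ofNat_of_zero_le hb
  -- The threshold ensures `Q ≤ q`, `b < q` and the condition `(n + 1) * m < q` for integer lifts.
  have inf : ∀ R S : ℤ[X], (∀ q : ℕ, Q + (n + 1) * m + m < q → R.eval (q : ℤ) = S.eval (q : ℤ)) →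
      R = S := fun R S h => by
    refine eq_of_infinite_eval_eq R S (Set.Infinite.mono (s := Nat.cast '' Set.Ioi
      (Q + (n + 1) * m + m)) ?_ ((Set.Ioi_infinite _).image Nat.cast_injective.injOn))
    rintro _ ⟨q, hq, rfl⟩
    exact h q hq
  constructor <;> refine inf _ _ fun q hq => ?_
  · have h := mul_eval_charPoly_restrict_K (n := n + 1) (by omega) (a := ε - m) (b := m) m q
      (by omega) le_rfl (by omega)
    rw [card_isModColoring h0 h1 hb (by omega), Nat.cast_mul, ← hP q (by omega)] at h
    exact mul_left_cancel₀ (by exact_mod_cast (by omega : q ≠ 0)) h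
  · rw [eval_charPoly_K (n := n + 1) (a := ε - m) (b := m) m q (by omega) le_rfl (by omega),
      card_isModColoring h0 h1 hb (by omega), Nat.cast_mul, ← hP q (by omega), eval_mul, eval_X]

end IntegralGainGraph

theorem mainTheorem2 (n : ℕ) (hn : 1 ≤ n) (a b : ℤ) (hab : a ≤ b) :
    (a + b = 0 →
      Arrangement.charPoly (Arrangement.restrict (IntegralGainGraph.K n a b).arrangement
          (zeroSum n)) =
        (-1) ^ (n - 1) * ∏ i ∈ Finset.Icc 1 (n - 1), (C (b * (n : ℤ)) - X + C (i : ℤ)) ∧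
      Arrangement.charPoly (IntegralGainGraph.K n a b).arrangement =
        X * ((-1) ^ (n - 1) * ∏ i ∈ Finset.Icc 1 (n - 1), (C (b * (n : ℤ)) - X + C (i : ℤ)))) ∧
    (a + b = 1 →
      Arrangement.charPoly (Arrangement.restrict (IntegralGainGraph.K n a b).arrangement
          (zeroSum n)) =
        (-1) ^ (n - 1) * (C (b * (n : ℤ)) - X) ^ (n - 1) ∧
      Arrangement.charPoly (IntegralGainGraph.K n a b).arrangement =
        X * ((-1) ^ (n - 1) * (C (b * (n : ℤ)) - X) ^ (n - 1))) := by
  obtain ⟨n, rfl⟩ := Nat.exists_eq_add_of_le' hn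
  simp only [Nat.add_sub_cancel]
  constructor
  · intro h
    obtain rfl : a = 0 - b := by omega
    have hb : 0 ≤ b := by omega
    refine IntegralGainGraph.charPoly_K_of_eval le_rfl zero_le_one hb _ ((b * (n + 1)).toNat + n + 1) fun q hq => ?_
    -- Splitting off `n` as well makes each factor `q' + n - i` of the falling factorial an
    -- untruncated subtraction.
    obtain ⟨q', hq'⟩ := Int.eq_ofNat_of_zero_le (by omega : 0 ≤ (q : ℤ) - b * (n + 1) - n - 1)
    rw [IntegralGainGraph.card_isRepresentative_zero (q' := q' + n) hb (by push_cast; omega),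
      Nat.descFactorial_eq_prod_range, eval_mul, eval_pow, eval_neg, eval_one, eval_prod,
      ← Finset.Ico_add_one_right_eq_Icc,
      Finset.prod_Ico_eq_prod_range, Nat.add_sub_cancel, Nat.cast_prod]
    nth_rw 1 [← Finset.card_range n]
    rw [← Finset.prod_const, ← Finset.prod_mul_distrib]
    refine Finset.prod_congr rfl fun i hi => ?_
    have := Finset.mem_range.1 hi
    rw [Nat.cast_sub (by omega)]
    simp only [eval_add, eval_sub, eval_C, eval_X]
    push_cast
    linear_combination hq'
  · intro h
    obtain rfl : a = 1 - b := by omega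
    have hb : 0 ≤ b := by omega
    refine IntegralGainGraph.charPoly_K_of_eval zero_le_one le_rfl hb _ ((b * (n + 1)).toNat + 1) fun q hq => ?_
    obtain ⟨q', hq'⟩ := Int.eq_ofNat_of_zero_le (by omega : 0 ≤ (q : ℤ) - b * (n + 1) - 1)
    rw [IntegralGainGraph.card_isRepresentative_one (q' := q' + 1) hb (by push_cast; omega) q'.succ_pos, eval_mul,
      eval_pow, eval_pow, ← mul_pow, Nat.cast_pow]
    congr 1
    simp only [eval_neg, eval_one, eval_sub, eval_C, eval_X]
    push_cast
    linear_combination hq'
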